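/- Let $\mathbb T$ be the unit circle with normalized Lebesgue measure, let $H^2\subset L^2(\mathbb T)$ be the Hardy space of functions whose Fourier coefficients of negative index vanish, and let $P$ be the orthogonal projection of $L^2(\mathbb T)$ onto $H^2$. For $f\in L^\infty(\mathbb T)$ let $T_f$ be the Toeplitz operator on $H^2$ given by $T_f g=P(fg)$, and let $T_f^*$ be its adjoint. A function $\vartheta\in H^2$ is called inner if $|\vartheta|=1$ a.e. on $\mathbb T$; a bounded operator between Hilbert spaces is called a partial isometry if it is isometric on the orthogonal complement of its kernel. Let $f\in L^\infty(\mathbb T)$ be not almost everywhere zero. Then the following statements are equivalent: 1. $T_f$ is a partial isometry; 2. $T_f^*$ is a partial isometry; 3. $f$ is inner or $\bar f$ is inner. -/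

import Mathlib

open MeasureTheory
open scoped ENNReal ComplexConjugate

namespace ToeplitzPI

noncomputable section

instance instFactTwoPiPos : Fact (0 < 2 * Real.pi) := ⟨Real.two_pi_pos⟩

/-- The unit circle, parametrized by the angle `t` modulo `2π` (the point being `exp (i t)`). -/
abbrev Torus : Type := AddCircle (2 * Real.pi)

/-- Normalized Lebesgue (Haar) measure on the circle. -/
abbrev torusMeasure : Measure Torus := AddCircle.haarAddCircle

/-- The Hilbert space `L²(𝕋)` of complex functions. -/
abbrev L2 : Type := Lp ℂ 2 torusMeasure

/-- The space `L^∞(𝕋)` of complex functions. -/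
abbrev LInfty : Type := Lp ℂ ∞ torusMeasure

/-- The Hardy space `H²`: the elements of `L²(𝕋)` whose Fourier coefficients of negative index
vanish. -/
def H2 : Submodule ℂ L2 where
  carrier := {g | ∀ n : ℤ, n < 0 → fourierCoeff (g : Torus → ℂ) n = 0}
  zero_mem' := by
    intro n _
    rw [← fourierBasis_repr]
    simp
  add_mem' := by
    intro a b ha hb n hn
    have h1 := ha n hn
    have h2 := hb n hn
    rw [← fourierBasis_repr] at h1 h2 ⊢
    simp [h1, h2]
  smul_mem' := by
    intro c a ha n hn
    have h1 := ha n hn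
    rw [← fourierBasis_repr] at h1 ⊢
    simp [h1]

theorem mem_H2 (g : L2) : g ∈ H2 ↔ ∀ n : ℤ, n < 0 → fourierCoeff (g : Torus → ℂ) n = 0 :=
  Iff.rfl

theorem isClosed_H2 : IsClosed (H2 : Set L2) := by
  have h : (H2 : Set L2) =
      ⋂ (n : ℤ) (_ : n < 0), {g : L2 | inner ℂ (fourierBasis (T := 2 * Real.pi) n) g = 0} := by
    ext g
    simp only [SetLike.mem_coe, mem_H2, Set.mem_iInter, Set.mem_ofPred_eq,
      ← HilbertBasis.repr_apply_apply, fourierBasis_repr]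
  rw [h]
  exact isClosed_iInter fun n => isClosed_iInter fun _ =>
    isClosed_eq (continuous_const.inner continuous_id) continuous_const

instance instCompleteSpaceH2 : CompleteSpace H2 := isClosed_H2.completeSpace_coe

/-- The operator `g ↦ f g` on `L²(𝕋)`, for `f ∈ L^∞(𝕋)`. -/
def mulOp (f : LInfty) : L2 →L[ℂ] L2 :=
  (ContinuousLinearMap.mul ℂ ℂ).holderL torusMeasure ∞ 2 2 f

theorem coeFn_mulOp (f : LInfty) (g : L2) :
    mulOp f g =ᵐ[torusMeasure] fun t => f t * g t :=
  (ContinuousLinearMap.mul ℂ ℂ).coeFn_holder f g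

/-- The Toeplitz operator `T_f g = P (f g)` on `H²` with symbol `f ∈ L^∞(𝕋)`, where `P` is the
orthogonal projection of `L²(𝕋)` onto `H²`. -/
def toeplitz (f : LInfty) : H2 →L[ℂ] H2 :=
  H2.orthogonalProjectionOnto ∘L mulOp f ∘L H2.subtypeL

/-- A function `θ` on the circle is inner if it belongs to `H²` and `|θ| = 1` almost everywhere. -/
def IsInner (θ : Torus → ℂ) : Prop :=
  (∃ h : MemLp θ 2 torusMeasure, h.toLp θ ∈ H2) ∧ ∀ᵐ t ∂torusMeasure, ‖θ t‖ = 1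

/-- A bounded operator between Hilbert spaces is a partial isometry if it is isometric on the
orthogonal complement of its kernel. -/
def IsPartialIsometry {H K : Type*} [NormedAddCommGroup H] [InnerProductSpace ℂ H]
    [NormedAddCommGroup K] [InnerProductSpace ℂ K] (A : H →L[ℂ] K) : Prop :=
  ∀ x ∈ (LinearMap.ker (A : H →ₗ[ℂ] K))ᗮ, ‖A x‖ = ‖x‖

end

end ToeplitzPI

/-! The adjoint of a partial isometry is one, and `T_f^* = T_{conj f}`; an inner symbol multiplies
`H²` isometrically into itself. This leaves 1 → 3. Let `T_f` be a partial isometry and `M = (ker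
T_f)ᗮ`. Multiplication by `f` is no larger than `T_f` in norm, so for `g ∈ M` we get `‖g‖ = ‖P(fg)‖
≤ ‖fg‖ ≤ ‖g‖`; hence `fg ∈ H²` and `‖fg‖ = ‖g‖`. Both survive multiplication by `z`, so `M` is shift
invariant. A wandering vector `q ∈ M` has constant nonzero modulus, and `|fq|²`, `|q|²` have the
same Fourier coefficients; thus `|f| = 1` a.e. If `1 ∈ M`, then `f = f · 1 ∈ H²`. Otherwise some `g
∈ ker T_f` has mean `c ≠ 0`, and `(g - c)/z` also lies in the kernel; comparing coefficients of `fg`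
and `f(g - c)/z` kills those of `f` of positive index, so `conj f ∈ H²`. -/

namespace ToeplitzPI

/-! ### Partial isometries and their adjoints. -/

section Hilbert

variable {H K : Type*} [NormedAddCommGroup H] [InnerProductSpace ℂ H]
  [NormedAddCommGroup K] [InnerProductSpace ℂ K]

/-- A partial isometry preserves inner products on the orthogonal complement of its kernel. -/
theorem IsPartialIsometry.inner_map_map {A : H →L[ℂ] K} (hA : IsPartialIsometry A) {x y : H}
    (hx : x ∈ (LinearMap.ker (A : H →ₗ[ℂ] K))ᗮ) (hy : y ∈ (LinearMap.ker (A : H →ₗ[ℂ] K))ᗮ) :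
    inner ℂ (A x) (A y) = inner ℂ x y := by
  let B : (LinearMap.ker (A : H →ₗ[ℂ] K))ᗮ →ₗᵢ[ℂ] K :=
    { toLinearMap := (A : H →ₗ[ℂ] K) ∘ₗ (LinearMap.ker (A : H →ₗ[ℂ] K))ᗮ.subtype
      norm_map' := fun z => hA z z.2 }
  exact B.inner_map_map ⟨x, hx⟩ ⟨y, hy⟩

variable [CompleteSpace H]

/-- Orthogonal decomposition along the kernel of a bounded operator. -/
theorem exists_add_of_ker (A : H →L[ℂ] K) (x : H) :
    ∃ a ∈ LinearMap.ker (A : H →ₗ[ℂ] K), ∃ b ∈ (LinearMap.ker (A : H →ₗ[ℂ] K))ᗮ, x = a + b := by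
  have : CompleteSpace (LinearMap.ker (A : H →ₗ[ℂ] K)) := A.isClosed_ker.completeSpace_coe
  obtain ⟨a, ha, b, hb, h⟩ := (LinearMap.ker (A : H →ₗ[ℂ] K)).exists_add_mem_mem_orthogonal x
  exact ⟨a, ha, b, hb, h⟩

/-- If a partial isometry preserves the norm of `x`, then `x` is orthogonal to its kernel. -/
theorem IsPartialIsometry.mem_orthogonal_ker {A : H →L[ℂ] K} (hA : IsPartialIsometry A) {x : H}
    (hx : ‖A x‖ = ‖x‖) : x ∈ (LinearMap.ker (A : H →ₗ[ℂ] K))ᗮ := by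
  obtain ⟨a, ha, b, hb, rfl⟩ := exists_add_of_ker A x
  have ha0 : A a = 0 := ha
  have h := norm_add_sq_eq_norm_sq_add_norm_sq_of_inner_eq_zero a b
    (Submodule.inner_right_of_mem_orthogonal ha hb)
  rw [← hx, map_add, ha0, zero_add, hA b hb] at h
  have : a = 0 := by
    rw [← norm_eq_zero]
    nlinarith [norm_nonneg a]
  simpa [this] using hb

theorem IsPartialIsometry.norm_apply_le {A : H →L[ℂ] K} (hA : IsPartialIsometry A) (x : H) :
    ‖A x‖ ≤ ‖x‖ := by
  obtain ⟨a, ha, b, hb, rfl⟩ := exists_add_of_ker A x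
  have ha0 : A a = 0 := ha
  have h := norm_add_sq_eq_norm_sq_add_norm_sq_of_inner_eq_zero a b
    (Submodule.inner_right_of_mem_orthogonal ha hb)
  rw [map_add, ha0, zero_add, hA b hb]
  nlinarith [norm_nonneg a, norm_nonneg b, norm_nonneg (a + b)]

variable [CompleteSpace K]

/-- The range of `A` is dense in `(ker A*)ᗮ`, and `A* A b = b` for `b ∈ (ker A)ᗮ`, so `A*` preserves
norms on the range and, by continuity, on its closure. -/
theorem IsPartialIsometry.adjoint {A : H →L[ℂ] K} (hA : IsPartialIsometry A) :
    IsPartialIsometry (ContinuousLinearMap.adjoint A) := by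
  intro y hy
  have h := ContinuousLinearMap.orthogonal_ker (ContinuousLinearMap.adjoint A)
  rw [ContinuousLinearMap.adjoint_adjoint] at h
  have hy' : y ∈ (LinearMap.range (A : H →ₗ[ℂ] K)).topologicalClosure := h ▸ hy
  have hcl : IsClosed {y : K | ‖ContinuousLinearMap.adjoint A y‖ = ‖y‖} :=
    isClosed_eq (by fun_prop) (by fun_prop)
  refine closure_minimal ?_ hcl hy'
  rintro _ ⟨x, rfl⟩
  obtain ⟨a, ha, b, hb, rfl⟩ := exists_add_of_ker A x
  have ha0 : A a = 0 := ha
  have hAb : ContinuousLinearMap.adjoint A (A b) = b := by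
    refine ext_inner_right ℂ fun u => ?_
    obtain ⟨c, hc, d, hd, rfl⟩ := exists_add_of_ker A u
    have hc0 : A c = 0 := hc
    rw [ContinuousLinearMap.adjoint_inner_left, map_add, hc0, zero_add, hA.inner_map_map hb hd,
      inner_add_right, Submodule.inner_left_of_mem_orthogonal hc hb, zero_add]
  simp [ha0, hAb, hA b hb]

theorem isPartialIsometry_adjoint_iff (A : H →L[ℂ] K) :
    IsPartialIsometry (ContinuousLinearMap.adjoint A) ↔ IsPartialIsometry A :=
  ⟨fun h => by simpa using h.adjoint, fun h => h.adjoint⟩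

end Hilbert

/-! ### Uniqueness of Fourier coefficients for measures and densities. -/

section Uniqueness

/-- Finite measures on the circle with the same Fourier coefficients agree. -/
theorem measure_eq_of_integral_fourier {ν₁ ν₂ : Measure Torus} [IsFiniteMeasure ν₁]
    [IsFiniteMeasure ν₂] (h : ∀ n : ℤ, ∫ t, fourier n t ∂ν₁ = ∫ t, fourier n t ∂ν₂) :
    ν₁ = ν₂ := by
  -- The trigonometric polynomials form a star subalgebra separating points, so they determine a
  -- finite measure.
  refine ext_of_forall_mem_subalgebra_integral_eq_of_pseudoEMetric_complete_countable (𝕜 := ℂ)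
    (A := fourierSubalgebra.comap (BoundedContinuousFunction.toContinuousMapStarₐ ℂ)) ?_ ?_
  · intro x y hxy
    obtain ⟨_, ⟨g, hg, rfl⟩, hgxy⟩ := fourierSubalgebra_separatesPoints (T := 2 * Real.pi) hxy
    exact ⟨g, ⟨g, ⟨BoundedContinuousFunction.mkOfCompact g, hg, rfl⟩, rfl⟩, hgxy⟩
  · intro g hg
    have hg' : (g : C(Torus, ℂ)) ∈ Submodule.span ℂ (Set.range (fourier (T := 2 * Real.pi))) := by
      rw [← fourierSubalgebra_coe]
      exact hg
    have key : ∀ φ ∈ Submodule.span ℂ (Set.range (fourier (T := 2 * Real.pi))),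
        ∫ t, φ t ∂ν₁ = ∫ t, φ t ∂ν₂ := by
      intro φ hφ
      have hi (ν : Measure Torus) [IsFiniteMeasure ν] (ψ : C(Torus, ℂ)) : Integrable ψ ν :=
        (BoundedContinuousFunction.mkOfCompact ψ).integrable ν
      induction hφ using Submodule.span_induction with
      | mem φ hφ => obtain ⟨n, rfl⟩ := hφ; exact h n
      | zero => simp
      | add a b _ _ ha hb =>
        simp only [ContinuousMap.add_apply]
        rw [integral_add (hi _ a) (hi _ b), integral_add (hi _ a) (hi _ b), ha, hb]
      | smul c a _ ha =>
        simp only [ContinuousMap.smul_apply]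
        rw [integral_smul, integral_smul, ha]
    exact key _ hg'

/-- Nonnegative integrable functions on the circle with the same Fourier coefficients agree
almost everywhere. -/
theorem ae_eq_of_integral_fourier {a b : Torus → ℝ} (ha : Integrable a torusMeasure)
    (hb : Integrable b torusMeasure) (ha0 : ∀ t, 0 ≤ a t) (hb0 : ∀ t, 0 ≤ b t)
    (h : ∀ n : ℤ, ∫ t, fourier n t * (a t : ℂ) ∂torusMeasure =
      ∫ t, fourier n t * (b t : ℂ) ∂torusMeasure) : a =ᵐ[torusMeasure] b := by
  have := isFiniteMeasure_withDensity_ofReal ha.2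
  have := isFiniteMeasure_withDensity_ofReal hb.2
  have hint {c : Torus → ℝ} (hc : Integrable c torusMeasure) (hc0 : ∀ t, 0 ≤ c t) (n : ℤ) :
      ∫ t, fourier n t ∂(torusMeasure.withDensity fun t => ENNReal.ofReal (c t)) =
        ∫ t, fourier n t * (c t : ℂ) ∂torusMeasure := by
    rw [integral_withDensity_eq_integral_toReal_smul₀ hc.1.aemeasurable.ennreal_ofReal
      (Filter.Eventually.of_forall fun _ => ENNReal.ofReal_lt_top)]
    refine integral_congr_ae (Filter.Eventually.of_forall fun t => ?_)
    simp only [ENNReal.toReal_ofReal (hc0 t), Complex.real_smul]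
    ring
  have hν := measure_eq_of_integral_fourier
    (ν₁ := torusMeasure.withDensity fun t => ENNReal.ofReal (a t))
    (ν₂ := torusMeasure.withDensity fun t => ENNReal.ofReal (b t))
    fun n => by rw [hint ha ha0, hint hb hb0, h]
  rw [withDensity_eq_iff_of_sigmaFinite ha.1.aemeasurable.ennreal_ofReal
    hb.1.aemeasurable.ennreal_ofReal] at hν
  filter_upwards [hν] with t ht
  exact (ENNReal.ofReal_eq_ofReal_iff (ha0 t) (hb0 t)).1 ht

end Uniqueness

/-! ### Multiplication operators, the bilateral shift, and bounded symbols in `H²`. -/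

section Multiplication

theorem mulOp_comm (f g : LInfty) (a : L2) : mulOp f (mulOp g a) = mulOp g (mulOp f a) := by
  refine Lp.ext ?_
  filter_upwards [coeFn_mulOp f (mulOp g a), coeFn_mulOp g (mulOp f a), coeFn_mulOp f a,
    coeFn_mulOp g a] with t h1 h2 h3 h4
  rw [h1, h2, h3, h4]
  ring

theorem inner_mulOp_left (f : LInfty) (a b : L2) :
    inner ℂ (mulOp f a) b = inner ℂ a (mulOp (star f) b) := by
  rw [MeasureTheory.L2.inner_def, MeasureTheory.L2.inner_def]
  refine integral_congr_ae ?_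
  filter_upwards [coeFn_mulOp f a, coeFn_mulOp (star f) b, Lp.coeFn_star f] with t h1 h2 h3
  rw [h1, h2, h3]
  simp only [RCLike.inner_apply, map_mul, Pi.star_apply, RCLike.star_def]
  ring

/-- The operator of multiplication by `exp (i n t)` on `L²(𝕋)`. -/
noncomputable def shift (n : ℤ) : L2 →L[ℂ] L2 := mulOp (fourierLp ∞ n)

theorem coeFn_shift (n : ℤ) (a : L2) :
    shift n a =ᵐ[torusMeasure] fun t => fourier n t * a t := by
  filter_upwards [coeFn_mulOp (fourierLp ∞ n) a, coeFn_fourierLp (T := 2 * Real.pi) ∞ n]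
    with t h1 h2
  rw [shift, h1, h2]

theorem mulOp_shift (f : LInfty) (n : ℤ) (a : L2) : mulOp f (shift n a) = shift n (mulOp f a) :=
  mulOp_comm _ _ _

theorem shift_shift (m n : ℤ) (a : L2) : shift m (shift n a) = shift (m + n) a := by
  refine Lp.ext ?_
  filter_upwards [coeFn_shift m (shift n a), coeFn_shift n a, coeFn_shift (m + n) a]
    with t h1 h2 h3
  rw [h1, h2, h3, fourier_add]
  ring

theorem shift_zero (a : L2) : shift 0 a = a := by
  refine Lp.ext ?_
  filter_upwards [coeFn_shift 0 a] with t h1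
  rw [h1, fourier_zero, one_mul]

theorem shift_fourierLp (n k : ℤ) : shift n (fourierLp 2 k) = fourierLp 2 (n + k) := by
  refine Lp.ext ?_
  filter_upwards [coeFn_shift n (fourierLp 2 k), coeFn_fourierLp (T := 2 * Real.pi) 2 k,
    coeFn_fourierLp (T := 2 * Real.pi) 2 (n + k)] with t h1 h2 h3
  rw [h1, h2, h3, fourier_add]

theorem inner_shift_shift (n : ℤ) (a b : L2) : inner ℂ (shift n a) (shift n b) = inner ℂ a b := by
  rw [MeasureTheory.L2.inner_def, MeasureTheory.L2.inner_def]
  refine integral_congr_ae ?_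
  filter_upwards [coeFn_shift n a, coeFn_shift n b] with t h1 h2
  have h : fourier n t * conj (fourier n t) = 1 := by
    rw [← fourier_neg, ← fourier_add, add_neg_cancel, fourier_zero]
  rw [h1, h2]
  simp only [RCLike.inner_apply, map_mul]
  linear_combination (b t * conj (a t)) * h

theorem norm_shift (n : ℤ) (a : L2) : ‖shift n a‖ = ‖a‖ := by
  rw [norm_eq_sqrt_re_inner (𝕜 := ℂ), norm_eq_sqrt_re_inner (𝕜 := ℂ) a, inner_shift_shift]

theorem inner_shift_right (n : ℤ) (a b : L2) :
    inner ℂ a (shift n b) = inner ℂ (shift (-n) a) b := by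
  rw [← inner_shift_shift n (shift (-n) a) b, shift_shift, add_neg_cancel, shift_zero]

theorem inner_fourierLp_shift (n k : ℤ) (a : L2) :
    inner ℂ (fourierLp 2 k : L2) (shift n a) = inner ℂ (fourierLp 2 (k - n) : L2) a := by
  rw [inner_shift_right, shift_fourierLp, neg_add_eq_sub]

theorem inner_fourierLp_fourierLp (m n : ℤ) :
    inner ℂ (fourierLp 2 m : L2) (fourierLp 2 n : L2) = if m = n then 1 else 0 :=
  orthonormal_iff_ite.1 orthonormal_fourier m n

theorem fourierCoeff_eq_inner (g : L2) (n : ℤ) :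
    fourierCoeff (g : Torus → ℂ) n = inner ℂ (fourierLp 2 n : L2) g := by
  rw [← fourierBasis_repr, HilbertBasis.repr_apply_apply, coe_fourierBasis]

theorem hasSum_inner_fourierLp (g : L2) :
    HasSum (fun n : ℤ => inner ℂ (fourierLp 2 n : L2) g • (fourierLp 2 n : L2)) g := by
  simpa only [fourierCoeff_eq_inner] using hasSum_fourier_series_L2 g

theorem mem_H2_iff_inner {g : L2} :
    g ∈ H2 ↔ ∀ n : ℤ, n < 0 → inner ℂ (fourierLp 2 n : L2) g = 0 := by
  simp only [mem_H2, fourierCoeff_eq_inner]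

theorem fourierLp_mem_H2 {n : ℤ} (hn : 0 ≤ n) : (fourierLp 2 n : L2) ∈ H2 :=
  mem_H2_iff_inner.2 fun k hk => by
    rw [inner_fourierLp_fourierLp, if_neg (by omega)]

theorem shift_mem_H2 {n : ℤ} (hn : 0 ≤ n) {g : L2} (hg : g ∈ H2) : shift n g ∈ H2 :=
  mem_H2_iff_inner.2 fun k hk => by
    rw [inner_fourierLp_shift]
    exact mem_H2_iff_inner.1 hg _ (by omega)

/-- `fourierLp 2 0` is the constant 1, so this product serves throughout as `f` viewed in `L²`. -/
theorem coeFn_mulOp_fourierLp_zero (f : LInfty) :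
    mulOp f (fourierLp 2 0) =ᵐ[torusMeasure] f := by
  filter_upwards [coeFn_mulOp f (fourierLp 2 0), coeFn_fourierLp (T := 2 * Real.pi) 2 0]
    with t h1 h2
  rw [h1, h2, fourier_zero, mul_one]

theorem mulOp_fourierLp (f : LInfty) (n : ℤ) :
    mulOp f (fourierLp 2 n) = shift n (mulOp f (fourierLp 2 0)) := by
  rw [← mulOp_shift, shift_fourierLp, add_zero]

theorem inner_fourierLp_mulOp_star (f : LInfty) (n : ℤ) :
    inner ℂ (fourierLp 2 n : L2) (mulOp (star f) (fourierLp 2 0)) =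
      conj (inner ℂ (fourierLp 2 (-n) : L2) (mulOp f (fourierLp 2 0))) := by
  rw [← inner_mulOp_left, mulOp_fourierLp, ← inner_conj_symm, inner_fourierLp_shift, zero_sub]

/-- Membership of a bounded symbol in `H²`, tested on its Fourier coefficients, makes
multiplication by the symbol preserve `H²`. -/
theorem mulOp_mem_H2 {f : LInfty} (hf : mulOp f (fourierLp 2 0) ∈ H2) {g : L2} (hg : g ∈ H2) :
    mulOp f g ∈ H2 := by
  refine mem_H2_iff_inner.2 fun n hn => ?_
  -- Expand `g` in exponentials: the surviving terms have `k ≥ 0`, and there `f e_k` is a forward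
  -- shift of `f`.
  have h := ((hasSum_inner_fourierLp g).mapL (mulOp f)).mapL (innerSL ℂ (fourierLp 2 n : L2))
  refine h.unique ?_
  convert hasSum_zero using 2 with k
  rw [map_smul, map_smul, innerSL_apply_apply]
  rcases lt_or_ge k 0 with hk | hk
  · rw [mem_H2_iff_inner.1 hg k hk, zero_smul]
  · rw [mulOp_fourierLp, inner_fourierLp_shift, mem_H2_iff_inner.1 hf _ (by omega), smul_zero]

theorem norm_mulOp_of_norm_eq_one {f : LInfty} (hf : ∀ᵐ t ∂torusMeasure, ‖f t‖ = 1) (g : L2) :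
    ‖mulOp f g‖ = ‖g‖ := by
  rw [Lp.norm_def, Lp.norm_def]
  congr 1
  refine eLpNorm_congr_norm_ae ?_
  filter_upwards [hf, coeFn_mulOp f g] with t h1 h2
  rw [h2, norm_mul, h1, one_mul]

theorem isInner_iff (f : LInfty) :
    IsInner f ↔ mulOp f (fourierLp 2 0) ∈ H2 ∧ ∀ᵐ t ∂torusMeasure, ‖f t‖ = 1 := by
  have h2 : MemLp f 2 torusMeasure :=
    (memLp_congr_ae (coeFn_mulOp_fourierLp_zero f)).1 (Lp.memLp _)
  have h : h2.toLp f = mulOp f (fourierLp 2 0) :=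
    Lp.ext (h2.coeFn_toLp.trans (coeFn_mulOp_fourierLp_zero f).symm)
  exact and_congr_left fun _ => ⟨fun ⟨_, hm⟩ => h ▸ hm, fun hm => ⟨h2, h ▸ hm⟩⟩

theorem isInner_conj_iff (f : LInfty) :
    IsInner (fun t => conj (f t)) ↔
      mulOp (star f) (fourierLp 2 0) ∈ H2 ∧ ∀ᵐ t ∂torusMeasure, ‖f t‖ = 1 := by
  have hs : mulOp (star f) (fourierLp 2 0) =ᵐ[torusMeasure] fun t => conj (f t) := by
    filter_upwards [coeFn_mulOp_fourierLp_zero (star f), Lp.coeFn_star f] with t h1 h2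
    rw [h1, h2, Pi.star_apply, RCLike.star_def]
  have h2 : MemLp (fun t => conj (f t)) 2 torusMeasure := (memLp_congr_ae hs).1 (Lp.memLp _)
  have h : h2.toLp _ = mulOp (star f) (fourierLp 2 0) := Lp.ext (h2.coeFn_toLp.trans hs.symm)
  simp only [IsInner, RCLike.norm_conj]
  exact and_congr_left fun _ => ⟨fun ⟨_, hm⟩ => h ▸ hm, fun hm => ⟨h2, h ▸ hm⟩⟩

end Multiplication

/-! ### Toeplitz operators: adjoints, norm bounds, injectivity in the symbol. -/

section Toeplitz

theorem inner_toeplitz_right (f : LInfty) (u g : H2) :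
    inner ℂ u (toeplitz f g) = inner ℂ (u : L2) (mulOp f g) := by
  simp [toeplitz]

theorem inner_fourierLp_toeplitz (f : LInfty) (g : H2) {n : ℤ} (hn : 0 ≤ n) :
    inner ℂ (fourierLp 2 n : L2) (toeplitz f g : L2) =
      inner ℂ (fourierLp 2 n : L2) (mulOp f g) :=
  inner_toeplitz_right f ⟨_, fourierLp_mem_H2 hn⟩ g

theorem adjoint_toeplitz (f : LInfty) :
    ContinuousLinearMap.adjoint (toeplitz f) = toeplitz (star f) := by
  refine ContinuousLinearMap.ext fun g => ext_inner_left ℂ fun u => ?_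
  rw [ContinuousLinearMap.adjoint_inner_right, inner_toeplitz_right, ← inner_mulOp_left,
    ← inner_conj_symm, inner_toeplitz_right, inner_conj_symm]

theorem coe_toeplitz_of_mem {f : LInfty} {g : H2} (h : mulOp f g ∈ H2) :
    (toeplitz f g : L2) = mulOp f g :=
  congrArg Subtype.val (Submodule.orthogonalProjectionOnto_mem_subspace_eq_self (⟨_, h⟩ : H2))

/-- By Pythagoras, a vector that loses no norm under `P` has no component orthogonal to `H²`. -/
theorem mulOp_mem_H2_of_norm_le {f : LInfty} {g : H2} (h : ‖mulOp f g‖ ≤ ‖toeplitz f g‖) :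
    mulOp f g ∈ H2 := by
  have h1 := H2.norm_sq_eq_add_norm_sq_projection (mulOp f g)
  have h2 : ‖H2ᗮ.orthogonalProjectionOnto (mulOp f g)‖ = 0 := by
    have h3 : ‖H2.orthogonalProjectionOnto (mulOp f g)‖ = ‖toeplitz f g‖ := rfl
    rw [h3] at h1
    nlinarith [norm_nonneg (mulOp f g), norm_nonneg (H2ᗮ.orthogonalProjectionOnto (mulOp f g))]
  rw [norm_eq_zero, Submodule.orthogonalProjectionOnto_eq_zero_iff] at h2
  rwa [Submodule.orthogonal_orthogonal] at h2

theorem toeplitz_isometry_of_isInner {f : LInfty} (hf : IsInner f) (g : H2) :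
    ‖toeplitz f g‖ = ‖g‖ := by
  obtain ⟨h1, h2⟩ := (isInner_iff f).1 hf
  change ‖(toeplitz f g : L2)‖ = ‖(g : L2)‖
  rw [coe_toeplitz_of_mem (mulOp_mem_H2 h1 g.2), norm_mulOp_of_norm_eq_one h2]

/-- A bound for a Toeplitz operator bounds multiplication by its symbol. -/
theorem norm_mulOp_le_of_norm_toeplitz_le {f : LInfty} {C : ℝ}
    (h : ∀ g, ‖toeplitz f g‖ ≤ C * ‖g‖) (g : H2) : ‖mulOp f g‖ ≤ C * ‖g‖ := by
  have hC : 0 ≤ C * ‖g‖ := (norm_nonneg _).trans (h g)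
  set F := mulOp f (g : L2) with hF
  have hsum : HasSum (fun n : ℤ => ‖inner ℂ (fourierLp 2 n : L2) F‖ ^ 2) (‖F‖ ^ 2) := by
    have h1 := lp.hasSum_norm (p := 2) (by simp) (fourierBasis.repr F)
    simpa [fourierBasis_repr, fourierCoeff_eq_inner] using h1
  refine abs_le_of_sq_le_sq' ?_ hC |>.2
  refine hasSum_le_of_sum_le hsum fun s => ?_
  -- Replacing `g` by `z^m g` keeps its norm and moves the finitely many coefficients of `fg`
  -- indexed by `s` to nonnegative indices, where `P` leaves them intact; Bessel then bounds their
  -- sum.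
  obtain ⟨m, hm⟩ : ∃ m : ℕ, ∀ k ∈ s, 0 ≤ k + m := by
    refine ⟨∑ k ∈ s, k.natAbs, fun k hk => ?_⟩
    have := Finset.single_le_sum (f := fun k : ℤ => k.natAbs) (fun _ _ => Nat.zero_le _) hk
    omega
  let g' : H2 := ⟨shift m g, shift_mem_H2 (by omega) g.2⟩
  have hg' : ‖g'‖ = ‖g‖ := norm_shift m g
  have horth : Orthonormal ℂ (fun k : ℤ => (fourierLp 2 (k + m) : L2)) :=
    orthonormal_fourier.comp _ (add_left_injective _)
  calc ∑ k ∈ s, ‖inner ℂ (fourierLp 2 k : L2) F‖ ^ 2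
      = ∑ k ∈ s, ‖inner ℂ (fourierLp 2 (k + m) : L2) (toeplitz f g' : L2)‖ ^ 2 := by
        refine Finset.sum_congr rfl fun k hk => ?_
        rw [inner_fourierLp_toeplitz f g' (hm k hk), mulOp_shift, inner_fourierLp_shift,
          add_sub_cancel_right]
    _ ≤ ‖(toeplitz f g' : L2)‖ ^ 2 := horth.sum_inner_products_le _
    _ ≤ (C * ‖g‖) ^ 2 := by
        rw [← hg']
        exact pow_le_pow_left₀ (norm_nonneg _) (h g') 2

theorem toeplitz_ne_zero {f : LInfty} (hf : f ≠ 0) : toeplitz f ≠ 0 := by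
  intro h
  have h1 := norm_mulOp_le_of_norm_toeplitz_le (f := f) (C := 0) (by simp [h])
    ⟨_, fourierLp_mem_H2 le_rfl⟩
  rw [zero_mul, norm_le_zero_iff] at h1
  refine hf (Lp.ext ?_)
  filter_upwards [coeFn_mulOp_fourierLp_zero f, Lp.coeFn_zero ℂ 2 torusMeasure,
    Lp.coeFn_zero ℂ ∞ torusMeasure] with t h2 h3 h4
  rw [← h2, h4]
  change (mulOp f (fourierLp 2 0)) t = 0
  simp only at h1
  rw [h1, h3]
  rfl

end Toeplitz

/-! ### Symbols of partially isometric Toeplitz operators. -/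

section PartialIsometry

variable {f : LInfty}

theorem IsPartialIsometry.mulOp_mem_H2 (hT : IsPartialIsometry (toeplitz f)) {g : H2}
    (hg : g ∈ (LinearMap.ker (toeplitz f : H2 →ₗ[ℂ] H2))ᗮ) : mulOp f g ∈ H2 := by
  refine mulOp_mem_H2_of_norm_le ?_
  rw [hT g hg, ← one_mul ‖g‖]
  exact norm_mulOp_le_of_norm_toeplitz_le (fun g => by simpa using hT.norm_apply_le g) g

theorem IsPartialIsometry.inner_mulOp_mulOp (hT : IsPartialIsometry (toeplitz f)) {g h : H2}
    (hg : g ∈ (LinearMap.ker (toeplitz f : H2 →ₗ[ℂ] H2))ᗮ)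
    (hh : h ∈ (LinearMap.ker (toeplitz f : H2 →ₗ[ℂ] H2))ᗮ) :
    inner ℂ (mulOp f g) (mulOp f h) = inner ℂ (g : L2) (h : L2) := by
  rw [← coe_toeplitz_of_mem (hT.mulOp_mem_H2 hg), ← coe_toeplitz_of_mem (hT.mulOp_mem_H2 hh)]
  exact hT.inner_map_map hg hh

/-- The initial space of a partially isometric Toeplitz operator is shift invariant. -/
theorem IsPartialIsometry.shift_mem (hT : IsPartialIsometry (toeplitz f)) {g : H2}
    (hg : g ∈ (LinearMap.ker (toeplitz f : H2 →ₗ[ℂ] H2))ᗮ) {n : ℤ} (hn : 0 ≤ n) :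
    (⟨shift n g, shift_mem_H2 hn g.2⟩ : H2) ∈ (LinearMap.ker (toeplitz f : H2 →ₗ[ℂ] H2))ᗮ := by
  refine hT.mem_orthogonal_ker ?_
  have hmem := hT.mulOp_mem_H2 hg
  have h : ‖mulOp f (g : L2)‖ = ‖(g : L2)‖ := by
    rw [← coe_toeplitz_of_mem hmem]
    exact hT g hg
  change ‖(toeplitz f _ : L2)‖ = ‖shift n (g : L2)‖
  rw [coe_toeplitz_of_mem (by rw [mulOp_shift]; exact shift_mem_H2 hn hmem), mulOp_shift,
    norm_shift, norm_shift, h]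

/-- A nonzero closed shift-invariant subspace of `H²` contains a nonzero wandering vector. -/
theorem exists_wandering {M : Submodule ℂ H2} [M.HasOrthogonalProjection] (hM : M ≠ ⊥)
    (hS : ∀ g ∈ M, ∀ n : ℤ, ∀ hn : 0 ≤ n, (⟨shift n g, shift_mem_H2 hn g.2⟩ : H2) ∈ M) :
    ∃ q ∈ M, q ≠ 0 ∧ ∀ n : ℤ, 0 < n → inner ℂ (q : L2) (shift n q) = 0 := by
  classical
  -- Take the least `k` whose coefficient functional is nonzero on `M`. The projection `q` of `e_k`
  -- onto `M` represents that functional, so `⟨q, z^n q⟩` is the coefficient of `q` at `k - n`, zero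
  -- by minimality.
  have hex : ∃ k : ℕ, ∃ m ∈ M, inner ℂ (fourierLp 2 (k : ℤ) : L2) (m : L2) ≠ 0 := by
    obtain ⟨m, hm, hm0⟩ := Submodule.exists_mem_ne_zero_of_ne_bot hM
    by_contra! hcon
    refine hm0 (Subtype.ext ((hasSum_inner_fourierLp (m : L2)).unique ?_))
    rw [ZeroMemClass.coe_zero]
    convert hasSum_zero using 2 with k
    rcases lt_or_ge k 0 with hk | hk
    · rw [mem_H2_iff_inner.1 m.2 k hk, zero_smul]
    · lift k to ℕ using hk
      rw [hcon k m hm, zero_smul]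
  obtain ⟨m, hm, hmk⟩ := Nat.find_spec hex
  set k := Nat.find hex with hk
  let e : H2 := ⟨fourierLp 2 (k : ℤ), fourierLp_mem_H2 (by omega)⟩
  have hq (g : H2) (hg : g ∈ M) : inner ℂ (M.orthogonalProjectionOnto e : H2) g = inner ℂ e g :=
    Submodule.inner_orthogonalProjectionOnto_eq_of_mem_right (⟨g, hg⟩ : M) e
  refine ⟨M.orthogonalProjectionOnto e, Subtype.prop _, fun h0 => hmk ?_, fun n hn => ?_⟩
  · have := hq m hm
    rw [h0, inner_zero_left] at this
    exact this.symm
  · refine (hq _ (hS _ (M.orthogonalProjectionOnto e).2 n hn.le)).trans ?_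
    change inner ℂ (fourierLp 2 (k : ℤ) : L2) (shift n _) = 0
    rw [inner_fourierLp_shift]
    rcases lt_or_ge ((k : ℤ) - n) 0 with hlt | hge
    · exact mem_H2_iff_inner.1 (Subtype.prop _) _ hlt
    · obtain ⟨j, hj⟩ := Int.eq_ofNat_of_zero_le hge
      rw [hj]
      have := Nat.find_min hex (m := j) (by omega)
      push Not at this
      exact this _ (Subtype.prop _)

theorem integral_fourier_mul_normSq (a : L2) (n : ℤ) :
    ∫ t, fourier n t * ((‖a t‖ ^ 2 : ℝ) : ℂ) ∂torusMeasure = inner ℂ a (shift n a) := by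
  rw [MeasureTheory.L2.inner_def]
  refine integral_congr_ae ?_
  filter_upwards [coeFn_shift n a] with t ht
  rw [ht, RCLike.inner_apply, mul_assoc, RCLike.mul_conj]
  push_cast
  rfl

theorem integrable_normSq (a : L2) : Integrable (fun t => ‖a t‖ ^ 2) torusMeasure :=
  (memLp_two_iff_integrable_sq_norm (Lp.aestronglyMeasurable a)).1 (Lp.memLp a)

theorem ae_normSq_eq {a b : L2}
    (h : ∀ n : ℤ, inner ℂ a (shift n a) = inner ℂ b (shift n b)) :
    ∀ᵐ t ∂torusMeasure, ‖a t‖ ^ 2 = ‖b t‖ ^ 2 :=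
  ae_eq_of_integral_fourier (integrable_normSq a) (integrable_normSq b)
    (fun _ => by positivity) (fun _ => by positivity)
    fun n => by rw [integral_fourier_mul_normSq, integral_fourier_mul_normSq, h]

/-- A nonzero wandering vector of the shift vanishes almost nowhere. -/
theorem ae_ne_zero_of_wandering {q : L2} (hq : q ≠ 0)
    (h : ∀ n : ℤ, 0 < n → inner ℂ q (shift n q) = 0) : ∀ᵐ t ∂torusMeasure, q t ≠ 0 := by
  have h' (n : ℤ) (hn : n ≠ 0) : inner ℂ q (shift n q) = 0 := by
    rcases hn.lt_or_gt with hn | hn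
    · rw [inner_shift_right, ← inner_conj_symm, h (-n) (by omega), map_zero]
    · exact h n hn
  -- All nonzero-index coefficients of `|q|²` vanish, so it equals the constant `‖q‖²`.
  have hc := ae_normSq_eq (a := q) (b := (‖q‖ : ℂ) • fourierLp 2 0) fun n => by
    rw [map_smul, inner_smul_left, inner_smul_right, inner_fourierLp_shift,
      inner_fourierLp_fourierLp]
    rcases eq_or_ne n 0 with rfl | hn
    · rw [shift_zero, inner_self_eq_norm_sq_to_K]
      simp [sq]
    · rw [h' n hn, if_neg (by omega)]
      simp
  filter_upwards [hc, Lp.coeFn_smul (‖q‖ : ℂ) (fourierLp 2 0 : L2),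
    coeFn_fourierLp (T := 2 * Real.pi) 2 0] with t h1 h2 h3 h0
  rw [h2, Pi.smul_apply, h3, fourier_zero, h0] at h1
  exact hq (by simpa using h1.symm)

/-- Polarized isometry on the shift-invariant initial space gives `|fq|² = |q|²` a.e. for a
wandering vector `q`, and `q` can be cancelled. -/
theorem IsPartialIsometry.ae_norm_eq_one (hT : IsPartialIsometry (toeplitz f)) (hf : f ≠ 0) :
    ∀ᵐ t ∂torusMeasure, ‖f t‖ = 1 := by
  have hM : (LinearMap.ker (toeplitz f : H2 →ₗ[ℂ] H2))ᗮ ≠ ⊥ := by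
    have : CompleteSpace (LinearMap.ker (toeplitz f : H2 →ₗ[ℂ] H2)) :=
      (toeplitz f).isClosed_ker.completeSpace_coe
    rw [Ne, Submodule.orthogonal_eq_bot_iff]
    intro h
    refine toeplitz_ne_zero hf (ContinuousLinearMap.ext fun g => ?_)
    have hg : g ∈ LinearMap.ker (toeplitz f : H2 →ₗ[ℂ] H2) := h ▸ Submodule.mem_top
    exact hg
  obtain ⟨q, hqM, hq0, hq⟩ := exists_wandering hM fun g hg n hn => hT.shift_mem hg hn
  have hq0' : (q : L2) ≠ 0 := fun h => hq0 (Subtype.ext h)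
  have hpos (n : ℤ) (hn : 0 ≤ n) : inner ℂ (mulOp f q) (shift n (mulOp f q)) =
      inner ℂ (q : L2) (shift n q) := by
    rw [← mulOp_shift f n (q : L2)]
    exact hT.inner_mulOp_mulOp (h := ⟨shift n q, shift_mem_H2 hn q.2⟩) hqM (hT.shift_mem hqM hn)
  have hall := ae_normSq_eq (a := mulOp f q) (b := q) fun n => by
    rcases le_total 0 n with hn | hn
    · exact hpos n hn
    · rw [inner_shift_right, ← inner_conj_symm, hpos (-n) (by omega), inner_conj_symm,
        inner_shift_right]
  filter_upwards [hall, ae_ne_zero_of_wandering hq0' hq, coeFn_mulOp f q] with t h1 h2 h3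
  rw [h3, norm_mul, mul_pow, mul_eq_right₀ (by simpa using h2)] at h1
  exact (pow_eq_one_iff_of_nonneg (norm_nonneg _) two_ne_zero).1 h1

/-- If the kernel of a partially isometric Toeplitz operator contains a function with nonzero mean,
then the symbol is coanalytic. -/
theorem IsPartialIsometry.mulOp_star_mem_H2 (hT : IsPartialIsometry (toeplitz f)) {g : H2}
    (hg : toeplitz f g = 0) (hg0 : inner ℂ (fourierLp 2 0 : L2) (g : L2) ≠ 0) :
    mulOp (star f) (fourierLp 2 0) ∈ H2 := by
  set c : ℂ := inner ℂ (fourierLp 2 0 : L2) (g : L2) with hc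
  -- The backward shift of `g`. It is again in the kernel: for `m` in the initial space, `⟨m, u⟩ =
  -- ⟨zm, g - c⟩ = 0`, since `zm` stays in that space and has mean zero.
  let u : L2 := shift (-1) ((g : L2) - c • fourierLp 2 0)
  have hu : u ∈ H2 := mem_H2_iff_inner.2 fun n hn => by
    rw [inner_fourierLp_shift, inner_sub_right, inner_smul_right, inner_fourierLp_fourierLp]
    rcases eq_or_ne n (-1) with rfl | hn1
    · simp [hc]
    · rw [if_neg (by omega), mem_H2_iff_inner.1 g.2 _ (by omega)]
      simp
  have huker : toeplitz f ⟨u, hu⟩ = 0 := by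
    have : CompleteSpace (LinearMap.ker (toeplitz f : H2 →ₗ[ℂ] H2)) :=
      (toeplitz f).isClosed_ker.completeSpace_coe
    suffices h : (⟨u, hu⟩ : H2) ∈ (LinearMap.ker (toeplitz f : H2 →ₗ[ℂ] H2))ᗮᗮ by
      rw [Submodule.orthogonal_orthogonal] at h
      exact h
    refine (Submodule.mem_orthogonal _ _).2 fun m hm => ?_
    change inner ℂ (m : L2) u = 0
    have h1 : inner ℂ (shift 1 (m : L2)) (g : L2) = 0 :=
      Submodule.inner_left_of_mem_orthogonal (K := LinearMap.ker (toeplitz f : H2 →ₗ[ℂ] H2))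
        hg (hT.shift_mem hm zero_le_one)
    have h2 : inner ℂ (shift 1 (m : L2)) (fourierLp 2 0 : L2) = 0 := by
      rw [← inner_conj_symm, inner_fourierLp_shift, mem_H2_iff_inner.1 m.2 _ (by omega), map_zero]
    rw [inner_shift_right, neg_neg, inner_sub_right, inner_smul_right, h1, h2, mul_zero, sub_zero]
  refine mem_H2_iff_inner.2 fun n hn => ?_
  rw [inner_fourierLp_mulOp_star]
  -- As `fu = (fg - cf)/z`, its coefficient at `-n - 1 ≥ 0` is that of `fg - cf` at `-n`; those of
  -- `fu` and `fg` vanish here, leaving `c` times the coefficient of `f`.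
  have h1 := inner_fourierLp_toeplitz f ⟨u, hu⟩ (n := -n - 1) (by omega)
  have h2 := inner_fourierLp_toeplitz f g (n := -n) (by omega)
  rw [huker, mulOp_shift, inner_fourierLp_shift, map_sub, map_smul, inner_sub_right,
    inner_smul_right, sub_neg_eq_add, sub_add_cancel, ← h2, hg] at h1
  have h3 : inner ℂ (fourierLp 2 (-n) : L2) ((0 : H2) : L2) = 0 := inner_zero_right _
  have h4 : inner ℂ (fourierLp 2 (-n - 1) : L2) ((0 : H2) : L2) = 0 := inner_zero_right _
  rw [h3, h4, zero_sub, eq_comm, neg_eq_zero, mul_eq_zero, or_iff_right hg0] at h1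
  rw [h1, map_zero]

theorem IsPartialIsometry.isInner_or (hT : IsPartialIsometry (toeplitz f)) (hf : f ≠ 0) :
    IsInner (fun t => f t) ∨ IsInner (fun t => conj (f t)) := by
  rw [isInner_conj_iff]
  -- The negation says exactly that the constant 1 is orthogonal to the kernel.
  by_cases h : ∃ g : H2, toeplitz f g = 0 ∧ inner ℂ (fourierLp 2 0 : L2) (g : L2) ≠ 0
  · obtain ⟨g, hg, hg0⟩ := h
    exact Or.inr ⟨hT.mulOp_star_mem_H2 hg hg0, hT.ae_norm_eq_one hf⟩
  · push Not at h
    refine Or.inl ((isInner_iff f).2 ⟨?_, hT.ae_norm_eq_one hf⟩)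
    refine hT.mulOp_mem_H2 (g := ⟨fourierLp 2 0, fourierLp_mem_H2 le_rfl⟩) ?_
    refine (Submodule.mem_orthogonal' _ _).2 fun g hg => h g hg

end PartialIsometry

end ToeplitzPI

theorem corollary3p7 (f : ToeplitzPI.LInfty) (hf : f ≠ 0) :
    [ToeplitzPI.IsPartialIsometry (ToeplitzPI.toeplitz f),
      ToeplitzPI.IsPartialIsometry (ContinuousLinearMap.adjoint (ToeplitzPI.toeplitz f)),
      ToeplitzPI.IsInner (fun t => f t) ∨ ToeplitzPI.IsInner (fun t => conj (f t))].TFAE := by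
  tfae_have 1 ↔ 2 := (ToeplitzPI.isPartialIsometry_adjoint_iff _).symm
  tfae_have 1 → 3 := fun h => h.isInner_or hf
  tfae_have 3 → 1 := by
    rintro (h | h)
    · exact fun g _ => ToeplitzPI.toeplitz_isometry_of_isInner h g
    · rw [← ToeplitzPI.isPartialIsometry_adjoint_iff, ToeplitzPI.adjoint_toeplitz]
      refine fun g _ => ToeplitzPI.toeplitz_isometry_of_isInner ?_ g
      obtain ⟨h1, h2⟩ := (ToeplitzPI.isInner_conj_iff f).1 h
      refine (ToeplitzPI.isInner_iff _).2 ⟨h1, ?_⟩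
      filter_upwards [h2, Lp.coeFn_star f] with t h3 h4
      rw [h4, Pi.star_apply, norm_star, h3]
  tfae_finish
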